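/- A system has $K$ sources, $N$ sensors and one destination, in slots $t=0,1,2,\dots$. The state $s_k(t)\in\{1,\dots,S_k\}$ of source $k$ is a Markov chain with an irreducible and aperiodic transition matrix $\mathbf R_k$ (and an arbitrary initial distribution); $\boldsymbol\beta_k$ is its stationary distribution, written as a row vector. In slot $t$ one sensor $a_t$ is scheduled. Let $\zeta_{nk}(t)\in\{0,1\}$ indicate that a measurement by sensor $n$ in slot $t$ would contain source $k$ and be delivered. Given $a_t$ and the history of source $k$ up to slot $t$ (its states up to slot $t$, and the actions and the indicators $\zeta_{n'k}$ of earlier slots), $\zeta_{nk}(t)=1$ with probability $p_{nk}^{(s_k(t))}q_n$, where $p_{nk}^{(s)},q_n\in[0,1]$; given in addition $a_t$ and all the $\zeta_{n'k}(t)$, the next state $s_k(t+1)$ has the distribution given by row $s_k(t)$ of $\mathbf R_k$. Assume $\sum_{n=1}^N\sum_{s=1}^{S_k}q_np_{nk}^{(s)}>0$ for all $k$. The age of information (AoI) of source $k$ is $\Delta_k(0)=0$, $\Delta_k(t+1)=1$ if $\zeta_{nk}(t)=1$ for the scheduled sensor $n=a_t$, and $\Delta_k(t+1)=\Delta_k(t)+1$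 otherwise. **Theorem.** Under the random sampling policy, where in each slot $a_t$ is uniform on $\{1,\dots,N\}$ and independent of the history of all sources, put $$\mathbf p_k=\frac1N\sum_{n=1}^N q_n\big[p_{nk}^{(1)}\ \cdots\ p_{nk}^{(S_k)}\big],\qquad \mathbf R_k^{(\mathrm{succ})}=\operatorname{diag}(\mathbf p_k)\mathbf R_k,\qquad \mathbf R_k^{(\mathrm{fail})}=(\mathbf I-\operatorname{diag}(\mathbf p_k))\mathbf R_k .$$ Then, for every $k$, the matrix $\mathbf I-\mathbf R_k^{(\mathrm{fail})}$ is invertible, all the expectations below are finite, and the expected long-term average AoI of source $k$ is $$\lim_{T\to\infty}\frac1T\,\mathbb E\Big[\sum_{t=1}^T\Delta_k(t)\Big]=E[\Delta_{\mathrm{random},k}]:=\boldsymbol\beta_k\mathbf R_k^{(\mathrm{succ})}\big(\mathbf I-\mathbf R_k^{(\mathrm{fail})}\big)^{-2}\mathbf 1^T ,$$ where $\mathbf 1$ is the all-ones row vector. Consequently the expected long-term average AoI of the system is $$\lim_{T\to\infty}\frac1T\,\mathbb E\Big[\sum_{t=1}^T\frac1K\sum_{k=1}^K\Delta_k(t)\Big]=\frac1K\sum_{k=1}^K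 E[\Delta_{\mathrm{random},k}] .$$ -/

import Mathlib

open MeasureTheory ProbabilityTheory Filter Topology

/-- A finite Markov chain with transition matrix `R` is aperiodic: at every state, the only
common divisor of all the lengths `m ≥ 1` of possible returns to that state is `1`. -/
def IsAperiodic {ι : Type*} [Fintype ι] [DecidableEq ι] (R : Matrix ι ι ℝ) : Prop :=
  ∀ i : ι, ∀ d : ℕ, (∀ m : ℕ, 0 < m → 0 < (R ^ m) i i → d ∣ m) → d = 1

/-- `β` is a stationary distribution of the finite Markov chain with transition matrix `R`:
a probability vector with `β R = β`. -/
def IsStationaryDistribution {ι : Type*} [Fintype ι] (R : Matrix ι ι ℝ) (β : ι → ℝ) : Prop :=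
  β ∈ stdSimplex ℝ ι ∧ Matrix.vecMul β R = β

/-- The parameters of a system of `N` sensors and `K` sources, with the standing assumptions. -/
structure SensingSystem (N K : ℕ) where
  /-- the number of states of each source -/
  S : Fin K → ℕ
  /-- the transition matrix of the state of each source -/
  R : (k : Fin K) → Matrix (Fin (S k)) (Fin (S k)) ℝ
  /-- `p n k s`: probability that a measurement by sensor `n` contains source `k` in state `s` -/
  p : Fin N → (k : Fin K) → Fin (S k) → ℝ
  /-- `q n`: probability that a measurement by sensor `n` is delivered -/
  q : Fin N → ℝ
  R_stochastic : ∀ k, R k ∈ Matrix.rowStochastic ℝ (Fin (S k))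
  R_irreducible : ∀ k, (R k).IsIrreducible
  R_aperiodic : ∀ k, IsAperiodic (R k)
  p_mem : ∀ n k s, p n k s ∈ Set.Icc (0 : ℝ) 1
  q_mem : ∀ n, q n ∈ Set.Icc (0 : ℝ) 1
  observable : ∀ k, 0 < ∑ n, ∑ s, q n * p n k s

namespace SensingSystem

variable {N K : ℕ} (M : SensingSystem N K)

/-- `p_k = (1/N) ∑ₙ qₙ [p_{nk}^{(1)}, …, p_{nk}^{(S_k)}]`. -/
noncomputable def pVec (k : Fin K) : Fin (M.S k) → ℝ :=
  fun s => (1 / (N : ℝ)) * ∑ n, M.q n * M.p n k s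

/-- `diag(p_k) R_k`. -/
noncomputable def Rsucc (k : Fin K) : Matrix (Fin (M.S k)) (Fin (M.S k)) ℝ :=
  Matrix.diagonal (M.pVec k) * M.R k

/-- `(I - diag(p_k)) R_k`. -/
noncomputable def Rfail (k : Fin K) : Matrix (Fin (M.S k)) (Fin (M.S k)) ℝ :=
  (1 - Matrix.diagonal (M.pVec k)) * M.R k

/-- `b R_k^(succ) (I - R_k^(fail))^{-2} 1ᵀ`, for a row vector `b`. -/
noncomputable def aoiFormula (k : Fin K) (b : Fin (M.S k) → ℝ) : ℝ :=
  b ⬝ᵥ Matrix.mulVec (M.Rsucc k * ((1 - M.Rfail k)⁻¹) ^ 2) 1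

/-- The random processes of the system, in the slots `t = 0, 1, 2, …`. -/
structure Processes (Ω : Type*) where
  /-- the state `s_k(t)` of source `k` -/
  state : ℕ → (k : Fin K) → Ω → Fin (M.S k)
  /-- the sensor `a_t` scheduled in slot `t` -/
  action : ℕ → Ω → Fin N
  /-- `ζ_{nk}(t)`: would the measurement of sensor `n` in slot `t` contain source `k` and be
  delivered -/
  success : ℕ → Fin N → Fin K → Ω → Bool

namespace Processes

variable {M} {Ω : Type*} (X : M.Processes Ω)

/-- The age of information `Δ_k(t)` of source `k` at the destination. -/
def aoi (k : Fin K) : ℕ → Ω → ℕ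
  | 0, _ => 0
  | t + 1, ω =>
      if ∑ n, (X.success t n k ω).toNat * (if X.action t ω = n then 1 else 0) = 1
      then 1 else aoi k t ω + 1

/-- The average `Δ'(t)` of the ages of the `K` sources. -/
noncomputable def avgAoi (t : ℕ) (ω : Ω) : ℝ :=
  (1 / (K : ℝ)) * ∑ k, (X.aoi k t ω : ℝ)

/-- The history of source `k` when the decision in slot `t` is made: its states in the slots
`0, …, t`, and the actions and its successes in the slots `0, …, t - 1`. -/
@[reducible] def sourceHistory (k : Fin K) (t : ℕ) : MeasurableSpace Ω :=
  (⨆ j ≤ t, MeasurableSpace.comap (X.state j k) ⊤) ⊔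
    ⨆ j < t, (MeasurableSpace.comap (X.action j) ⊤ ⊔
      ⨆ n, MeasurableSpace.comap (X.success j n k) ⊤)

/-- The joint history of all the sources. -/
@[reducible] def history (t : ℕ) : MeasurableSpace Ω := ⨆ k, X.sourceHistory k t

/-- The dynamics of the sources and of the sensors, whatever the scheduling policy.
Nothing is required of the dependence between different sources (or different sensors). -/
structure IsSystemEvolution [MeasurableSpace Ω] (μ : Measure Ω) : Prop where
  measurable_state : ∀ t k, Measurable (X.state t k)
  measurable_action : ∀ t, Measurable (X.action t)
  measurable_success : ∀ t n k, Measurable (X.success t n k)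
  /-- Given the history of source `k` and the action in slot `t`, the variable `ζ_{nk}(t)` is
  Bernoulli with parameter `p_{nk}^{(s_k(t))} q_n`. -/
  success_law : ∀ t n k,
    μ⟦X.success t n k ⁻¹' {true} |
        X.sourceHistory k t ⊔ MeasurableSpace.comap (X.action t) ⊤⟧
      =ᵐ[μ] fun ω => M.p n k (X.state t k ω) * M.q n
  /-- Given all that has happened to source `k` up to and including slot `t`, its next state is
  drawn from the row `s_k(t)` of `R_k`. -/
  state_law : ∀ t k (j : Fin (M.S k)),
    μ⟦X.state (t + 1) k ⁻¹' {j} |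
        X.sourceHistory k t ⊔ MeasurableSpace.comap (X.action t) ⊤ ⊔
          ⨆ n, MeasurableSpace.comap (X.success t n k) ⊤⟧
      =ᵐ[μ] fun ω => M.R k (X.state t k ω) j

/-- The random sampling policy: in each slot the scheduled sensor is uniform on the `N` sensors,
independently of the history. -/
def IsRandomSampling [MeasurableSpace Ω] (μ : Measure Ω) : Prop :=
  ∀ t n, μ⟦X.action t ⁻¹' {n} | X.history t⟧ =ᵐ[μ] fun _ => 1 / (N : ℝ)

end Processes

end SensingSystem

/-! Fix a source, with $\pi_t$ the law of its state, $Q=\mathbf R^{(\mathrm{fail})}$ and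
$u_t(j)=\mathbb E[\Delta(t);\,s(t)=j]$. Since $\Delta(t+1)=1+\Delta(t)(1-\text{delivery})$,
conditioning gives the linear recursion $u_{t+1}=\pi_{t+1}+u_tQ$ (`aoiByState_succ`).

Irreducibility and a positive delivery probability in some state make $I-Q$ invertible
(`isUnit_one_sub_killed`). Pairing the recursion with $w=(I-Q)^{-1}\mathbf 1$, for which
$Qw=w-\mathbf 1$, expresses the expected age $u_t\mathbf 1$ as $\pi_{t+1}w+u_tw-u_{t+1}w$. The
Poisson equation (`exists_poisson`) turns $\pi_{t+1}w$ into $\beta w$ plus another telescoping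
difference. All telescoped quantities are bounded, so the Cesàro means tend to $\beta w$
(`tendsto_cesaro_mass`). Stationarity identifies $\beta w$ with the stated formula
(`aoiFormula_eq`). -/

/-- Cesàro means of a sequence that differs from a constant by a bounded coboundary. -/
theorem tendsto_cesaro_of_bounded_coboundary {f g : ℕ → ℝ} {c C : ℝ}
    (hf : ∀ t, f t = c + g t - g (t + 1)) (hg : ∀ t, |g t| ≤ C) :
    Tendsto (fun T : ℕ => (1 / (T : ℝ)) * ∑ t ∈ Finset.Icc 1 T, f t) atTop (𝓝 c) := by
  have hsum : ∀ T : ℕ, ∑ t ∈ Finset.Icc 1 T, f t = T * c + (g 1 - g (T + 1)) := by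
    intro T
    induction T with
    | zero => simp
    | succ T ih =>
      rw [Finset.sum_Icc_succ_top (by omega), ih, hf]
      push_cast
      ring
  have herr : Tendsto (fun T : ℕ => (1 / (T : ℝ)) * (g 1 - g (T + 1))) atTop (𝓝 0) := by
    refine tendsto_one_div_atTop_nhds_zero_nat.zero_mul_isBoundedUnder_le ?_
    refine isBoundedUnder_of ⟨C + C, fun T => ?_⟩
    simp only [Function.comp_apply, Real.norm_eq_abs]
    exact (abs_sub _ _).trans (add_le_add (hg _) (hg _))
  have hlim := herr.const_add c
  rw [add_zero] at hlim
  refine hlim.congr' ?_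
  filter_upwards [eventually_ne_atTop 0] with T hT
  have hT' : (T : ℝ) ≠ 0 := Nat.cast_ne_zero.mpr hT
  rw [hsum]
  field_simp

/-! ### Irreducible stochastic matrices, killing and the Poisson equation -/

namespace Matrix

variable {ι : Type*} [Fintype ι]

theorem mulVec_mono_of_nonneg {A : Matrix ι ι ℝ} (hA : ∀ i j, 0 ≤ A i j) {x y : ι → ℝ}
    (h : x ≤ y) : A *ᵥ x ≤ A *ᵥ y := fun i =>
  Finset.sum_le_sum fun j _ => mul_le_mul_of_nonneg_left (h j) (hA i j)

theorem abs_dotProduct_le_of_mem_stdSimplex (z : ι → ℝ) {π : ι → ℝ} (hπ : π ∈ stdSimplex ℝ ι) :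
    |π ⬝ᵥ z| ≤ ∑ i, |z i| := by
  refine (Finset.abs_sum_le_sum_abs _ _).trans (Finset.sum_le_sum fun i _ => ?_)
  rw [abs_mul, abs_of_nonneg (hπ.1 i)]
  exact mul_le_of_le_one_left (abs_nonneg _) (mem_Icc_of_mem_stdSimplex hπ i).2

variable [DecidableEq ι] {R : Matrix ι ι ℝ}

theorem le_pow_mulVec_of_le_mulVec {A : Matrix ι ι ℝ} (hA : ∀ i j, 0 ≤ A i j) {y : ι → ℝ}
    (hy : y ≤ A *ᵥ y) (n : ℕ) : y ≤ (A ^ n) *ᵥ y := by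
  induction n with
  | zero => simp
  | succ n ih =>
    rw [pow_succ, ← mulVec_mulVec]
    exact ih.trans (mulVec_mono_of_nonneg (pow_apply_nonneg hA n) hy)

/-- Maximum principle: a subharmonic function of an irreducible stochastic matrix is constant. -/
theorem IsIrreducible.eq_const_of_le_mulVec (hirr : R.IsIrreducible)
    (hR : R ∈ rowStochastic ℝ ι) {y : ι → ℝ} (hy : y ≤ R *ᵥ y) (i j : ι) : y i = y j := by
  have : Nonempty ι := ⟨i⟩
  obtain ⟨m, hm⟩ := Finite.exists_max y
  suffices h : ∀ j, y j = y m by rw [h i, h j]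
  intro j
  obtain ⟨n, -, hn⟩ := (isIrreducible_iff_exists_pow_pos hirr.nonneg).mp hirr m j
  have hRn := pow_mem hR n
  have hle := le_pow_mulVec_of_le_mulVec hirr.nonneg hy n m
  by_contra hne
  -- If `y j` were below the maximum `y m`, its positive weight would pull the `n`-step average at
  -- `m` strictly below `y m`.
  have hlt : ((R ^ n) *ᵥ y) m < ∑ l, (R ^ n) m l * y m := by
    refine Finset.sum_lt_sum (fun l _ => ?_) ⟨j, Finset.mem_univ _, ?_⟩
    · exact mul_le_mul_of_nonneg_left (hm l) (nonneg_of_mem_rowStochastic hRn)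
    · exact mul_lt_mul_of_pos_left (lt_of_le_of_ne (hm j) hne) hn
  rw [← Finset.sum_mul, sum_row_of_mem_rowStochastic hRn, one_mul] at hlt
  exact absurd hlt hle.not_gt

theorem isUnit_of_mulVec_eq_zero {A : Matrix ι ι ℝ} (h : ∀ x, A *ᵥ x = 0 → x = 0) :
    IsUnit A := by
  rw [← mulVec_injective_iff_isUnit]
  intro x y hxy
  rw [← sub_eq_zero]
  exact h _ (by rw [mulVec_sub, sub_eq_zero]; exact hxy)

theorem diagonal_compl_mul_mulVec_apply (p x : ι → ℝ) (i : ι) :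
    (((1 - diagonal p) * R) *ᵥ x) i = (1 - p i) * (R *ᵥ x) i := by
  rw [← mulVec_mulVec, sub_mulVec, one_mulVec, Pi.sub_apply, mulVec_diagonal]
  ring

/-- Killing an irreducible chain with a probability that is positive at some state makes the
Green matrix exist. -/
theorem IsIrreducible.isUnit_one_sub_killed (hirr : R.IsIrreducible)
    (hR : R ∈ rowStochastic ℝ ι) {p : ι → ℝ} (hp : ∀ i, p i ∈ Set.Icc (0 : ℝ) 1) {i₀ : ι}
    (hi₀ : 0 < p i₀) : IsUnit (1 - (1 - diagonal p) * R) := by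
  refine isUnit_of_mulVec_eq_zero fun x hx => ?_
  rw [sub_mulVec, one_mulVec, sub_eq_zero] at hx
  -- A kernel vector satisfies `x = (1 - diagonal p) * R *ᵥ x`, so `|x|` is subharmonic for `R`,
  -- hence constant. At `i₀` the factor `1 - p i₀ < 1` then forces this constant to vanish.
  have habs : ∀ i, |x i| ≤ (1 - p i) * (R *ᵥ fun j => |x j|) i := by
    intro i
    conv_lhs => rw [hx]
    rw [diagonal_compl_mul_mulVec_apply, abs_mul, abs_of_nonneg (sub_nonneg.mpr (hp i).2)]
    refine mul_le_mul_of_nonneg_left ?_ (sub_nonneg.mpr (hp i).2)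
    refine (Finset.abs_sum_le_sum_abs _ _).trans (Finset.sum_le_sum fun j _ => ?_)
    rw [abs_mul, abs_of_nonneg (hirr.nonneg i j)]
  have hnn : ∀ i, 0 ≤ (R *ᵥ fun j => |x j|) i := fun i =>
    Finset.sum_nonneg fun j _ => mul_nonneg (hirr.nonneg i j) (abs_nonneg _)
  have hconst : ∀ i j, |x i| = |x j| := fun i j =>
    hirr.eq_const_of_le_mulVec hR (y := fun j => |x j|)
      (fun i => (habs i).trans (mul_le_of_le_one_left (hnn i) (by linarith [(hp i).1]))) i j
  have hval : (R *ᵥ fun j => |x j|) i₀ = |x i₀| := by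
    simp only [mulVec, dotProduct, hconst _ i₀, ← Finset.sum_mul,
      sum_row_of_mem_rowStochastic hR, one_mul]
  have hzero : |x i₀| = 0 := by
    have h := habs i₀
    rw [hval] at h
    nlinarith [abs_nonneg (x i₀)]
  funext i
  exact abs_eq_zero.mp ((hconst i i₀).trans hzero)

/-- Minimum principle, which avoids expanding the Green matrix in a series: at a minimum `m`, a
negative `w m` would give `w m ≥ 1 + (1 - p m) * w m ≥ 1 + w m`. -/
theorem one_le_of_eq_one_add_killed (hR : R ∈ rowStochastic ℝ ι) {p : ι → ℝ}
    (hp : ∀ i, p i ∈ Set.Icc (0 : ℝ) 1) {w : ι → ℝ}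
    (hw : w = 1 + ((1 - diagonal p) * R) *ᵥ w) (i : ι) : 1 ≤ w i := by
  have : Nonempty ι := ⟨i⟩
  obtain ⟨m, hm⟩ := Finite.exists_min w
  have hval : ∀ i, w i = 1 + (1 - p i) * (R *ᵥ w) i := fun i => by
    conv_lhs => rw [hw]
    rw [Pi.add_apply, diagonal_compl_mul_mulVec_apply, Pi.one_apply]
  have hmin : ∀ i, w m ≤ (R *ᵥ w) i := fun i => by
    calc w m = ∑ j, R i j * w m := by
          rw [← Finset.sum_mul, sum_row_of_mem_rowStochastic hR, one_mul]
      _ ≤ _ := Finset.sum_le_sum fun j _ =>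
          mul_le_mul_of_nonneg_left (hm j) (nonneg_of_mem_rowStochastic hR)
  have hpos : 0 ≤ w m := by
    by_contra! hneg
    have h1 := hval m
    have h2 := mul_le_mul_of_nonneg_left (hmin m) (sub_nonneg.mpr (hp m).2)
    nlinarith [(hp m).1, (hp m).2]
  rw [hval i]
  exact le_add_of_nonneg_right
    (mul_nonneg (sub_nonneg.mpr (hp i).2) (hpos.trans (hmin i)))

/-- Solvability of the Poisson equation of an irreducible chain. -/
theorem IsIrreducible.exists_poisson (hirr : R.IsIrreducible) (hR : R ∈ rowStochastic ℝ ι)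
    {β : ι → ℝ} (hβ : IsStationaryDistribution R β) (w : ι → ℝ) :
    ∃ z : ι → ℝ, ∀ i, w i = β ⬝ᵥ w + z i - (R *ᵥ z) i := by
  -- `1 - R` kills constants. Adding the rank-one projection onto them along `β` makes it
  -- invertible, and applying `β` to the perturbed equation shows that the correction is exactly `β
  -- ⬝ᵥ w`.
  have happ : ∀ x : ι → ℝ, (1 - R + vecMulVec 1 β) *ᵥ x
      = x - R *ᵥ x + (fun _ => β ⬝ᵥ x) := by
    intro x
    rw [add_mulVec, sub_mulVec, one_mulVec, vecMulVec_mulVec]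
    congr 1
    funext i
    simp
  have hconst : ∀ c : ℝ, β ⬝ᵥ (fun _ => c) = c := fun c => by
    rw [dotProduct, ← Finset.sum_mul, hβ.1.2, one_mul]
  have hdot : ∀ x : ι → ℝ, β ⬝ᵥ ((1 - R + vecMulVec 1 β) *ᵥ x) = β ⬝ᵥ x := by
    intro x
    rw [happ, dotProduct_add, dotProduct_sub, dotProduct_mulVec, hβ.2, sub_self, zero_add,
      hconst]
  have hunit : IsUnit (1 - R + vecMulVec 1 β) := by
    refine isUnit_of_mulVec_eq_zero fun x hx => ?_
    have h0 : β ⬝ᵥ x = 0 := by rw [← hdot, hx, dotProduct_zero]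
    have hharm : x = R *ᵥ x := by
      funext i
      have h := congrFun (happ x) i
      rw [hx, h0] at h
      simp only [Pi.zero_apply, Pi.add_apply, Pi.sub_apply] at h
      linarith
    funext i
    have hx' : x = fun _ => x i :=
      funext fun j => hirr.eq_const_of_le_mulVec hR hharm.le j i
    rw [hx', hconst] at h0
    exact h0
  obtain ⟨z, hz⟩ := (mulVec_surjective_iff_isUnit.mpr hunit) w
  refine ⟨z, fun i => ?_⟩
  rw [← hz, hdot, happ]
  simp only [Pi.add_apply, Pi.sub_apply]
  ring

/-- Long-run average of the total mass of `u`, where `u` is fed by the law `π` of an irreducible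
chain and loses mass through killing. -/
theorem IsIrreducible.tendsto_cesaro_mass (hirr : R.IsIrreducible)
    (hR : R ∈ rowStochastic ℝ ι) {p : ι → ℝ} (hp : ∀ i, p i ∈ Set.Icc (0 : ℝ) 1) {i₀ : ι}
    (hi₀ : 0 < p i₀) {β : ι → ℝ} (hβ : IsStationaryDistribution R β) {π u : ℕ → ι → ℝ}
    (hπ : ∀ t, π t ∈ stdSimplex ℝ ι) (hπs : ∀ t, π (t + 1) = π t ᵥ* R)
    (hu : ∀ t i, 0 ≤ u t i) (hu0 : u 0 = 0)
    (hus : ∀ t, u (t + 1) = π (t + 1) + u t ᵥ* ((1 - diagonal p) * R)) :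
    Tendsto (fun T : ℕ => (1 / (T : ℝ)) * ∑ t ∈ Finset.Icc 1 T, ∑ i, u t i) atTop
      (𝓝 (β ⬝ᵥ ((1 - (1 - diagonal p) * R)⁻¹ *ᵥ 1))) := by
  set Q := (1 - diagonal p) * R with hQ
  set w := (1 - Q)⁻¹ *ᵥ (1 : ι → ℝ) with hw
  have hunit : IsUnit (1 - Q) := hirr.isUnit_one_sub_killed hR hp hi₀
  have hdet : IsUnit (1 - Q).det := (isUnit_iff_isUnit_det _).mp hunit
  have hwQ : Q *ᵥ w = w - 1 := by
    have h : (1 - Q) *ᵥ w = 1 := by rw [hw, mulVec_mulVec, mul_nonsing_inv _ hdet, one_mulVec]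
    rw [sub_mulVec, one_mulVec] at h
    rw [← h]
    abel
  have hw1 : ∀ i, 1 ≤ w i :=
    one_le_of_eq_one_add_killed hR hp (by rw [← hQ, hwQ]; abel)
  obtain ⟨z, hz⟩ := hirr.exists_poisson hR hβ w
  have hstep : ∀ t, u (t + 1) ⬝ᵥ w = π (t + 1) ⬝ᵥ w + u t ⬝ᵥ w - ∑ i, u t i := by
    intro t
    rw [hus, add_dotProduct, ← dotProduct_mulVec, hwQ, dotProduct_sub, dotProduct_one]
    ring
  have hpoisson : ∀ t, π t ⬝ᵥ w = β ⬝ᵥ w + π t ⬝ᵥ z - π (t + 1) ⬝ᵥ z := by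
    intro t
    have hw' : w = (β ⬝ᵥ w) • (1 : ι → ℝ) + z - R *ᵥ z := by
      funext i
      simpa using hz i
    conv_lhs => rw [hw']
    rw [dotProduct_sub, dotProduct_add, dotProduct_smul, dotProduct_one, (hπ t).2, hπs,
      dotProduct_mulVec (π t), smul_eq_mul, mul_one]
  set W := ∑ i, |w i| with hW
  have hwW : ∀ i, w i ≤ W := fun i =>
    (le_abs_self _).trans (Finset.single_le_sum (f := fun i => |w i|)
      (fun j _ => abs_nonneg _) (Finset.mem_univ i))
  have hW1 : 1 ≤ W := (hw1 i₀).trans (hwW i₀)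
  have hmass : ∀ t, u t ⬝ᵥ w ≤ (∑ i, u t i) * W := fun t => by
    rw [Finset.sum_mul]
    exact Finset.sum_le_sum fun i _ => mul_le_mul_of_nonneg_left (hwW i) (hu t i)
  -- The bound `W * W` is preserved: the input `π (t + 1) ⬝ᵥ w` is at most `W`, so `W` must be lost.
  -- If the mass is at least `W`, its subtraction suffices; otherwise `u t ⬝ᵥ w` minus the mass is
  -- at most mass times `W - 1`, hence at most `W * W - W`.
  have huw : ∀ t, u t ⬝ᵥ w ≤ W * W := by
    intro t
    induction t with
    | zero => rw [hu0, zero_dotProduct]; positivity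
    | succ t ih =>
      have h1 := hstep t
      have h2 := (le_abs_self _).trans (abs_dotProduct_le_of_mem_stdSimplex w (hπ (t + 1)))
      have h3 := hmass t
      have h4 : u t ⬝ᵥ w - ∑ i, u t i ≤ W * W - W := by
        have h5 : 0 ≤ ∑ i, u t i := Finset.sum_nonneg fun i _ => hu t i
        by_cases hc : W ≤ ∑ i, u t i
        · linarith
        · have h6 := mul_le_mul_of_nonneg_right (not_le.mp hc).le (sub_nonneg.mpr hW1)
          nlinarith
      linarith
  have hf : ∀ t, ∑ i, u t i = β ⬝ᵥ w + (π (t + 1) ⬝ᵥ z + u t ⬝ᵥ w)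
      - (π (t + 1 + 1) ⬝ᵥ z + u (t + 1) ⬝ᵥ w) := by
    intro t
    rw [hstep, hpoisson (t + 1)]
    ring
  refine tendsto_cesaro_of_bounded_coboundary (g := fun t => π (t + 1) ⬝ᵥ z + u t ⬝ᵥ w)
    (C := ∑ i, |z i| + W * W) hf fun t => ?_
  have hnn : 0 ≤ u t ⬝ᵥ w :=
    Finset.sum_nonneg fun i _ => mul_nonneg (hu t i) (zero_le_one.trans (hw1 i))
  refine (abs_add_le _ _).trans (add_le_add (abs_dotProduct_le_of_mem_stdSimplex z (hπ _)) ?_)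
  rw [abs_of_nonneg hnn]
  exact huw t

end Matrix

/-! ### From conditional probabilities to expectations -/

/-- Tower property with the known factor `h` pulled out; every law of the model is used in this
integrated form. -/
theorem MeasureTheory.integral_mul_indicator_of_condExp_ae_eq {Ω : Type*}
    {m mΩ : MeasurableSpace Ω} {μ : Measure Ω} [IsFiniteMeasure μ] (hm : m ≤ mΩ) {A : Set Ω}
    (hA : MeasurableSet A) {φ h : Ω → ℝ} (hφ : μ⟦A | m⟧ =ᵐ[μ] φ) (hh : Measurable[m] h) {C : ℝ}
    (hC : ∀ ω, |h ω| ≤ C) :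
    ∫ ω, h ω * A.indicator (fun _ => (1 : ℝ)) ω ∂μ = ∫ ω, h ω * φ ω ∂μ := by
  have hint : Integrable (A.indicator fun _ => (1 : ℝ)) μ :=
    (integrable_const _).indicator hA
  have hmul := condExp_stronglyMeasurable_mul_of_bound hm hh.stronglyMeasurable hint C
    (Eventually.of_forall hC)
  calc ∫ ω, h ω * A.indicator (fun _ => (1 : ℝ)) ω ∂μ
      = ∫ ω, (μ[h * A.indicator (fun _ => (1 : ℝ)) | m]) ω ∂μ := (integral_condExp hm).symm
    _ = ∫ ω, h ω * φ ω ∂μ := by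
        refine integral_congr_ae ?_
        filter_upwards [hmul, hφ] with ω h1 h2
        rw [h1, Pi.mul_apply, h2]

/-! ### Delivery probabilities and the closed formula -/

namespace SensingSystem

variable {N K : ℕ} (M : SensingSystem N K)

theorem pVec_mem_Icc (hN : 0 < N) (k : Fin K) (s : Fin (M.S k)) :
    M.pVec k s ∈ Set.Icc (0 : ℝ) 1 := by
  have hN' : (0 : ℝ) < N := Nat.cast_pos.mpr hN
  have hnn : ∀ n, 0 ≤ M.q n * M.p n k s := fun n => mul_nonneg (M.q_mem n).1 (M.p_mem n k s).1
  refine ⟨mul_nonneg (by positivity) (Finset.sum_nonneg fun n _ => hnn n), ?_⟩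
  have hle : ∑ n, M.q n * M.p n k s ≤ ∑ _n : Fin N, (1 : ℝ) := Finset.sum_le_sum fun n _ =>
    mul_le_one₀ (M.q_mem n).2 (M.p_mem n k s).1 (M.p_mem n k s).2
  rw [Finset.sum_const, Finset.card_univ, Fintype.card_fin, nsmul_eq_mul, mul_one] at hle
  rw [pVec, one_div, inv_mul_le_iff₀ hN', mul_one]
  exact hle

theorem exists_pVec_pos (hN : 0 < N) (k : Fin K) : ∃ s, 0 < M.pVec k s := by
  have hobs := M.observable k
  rw [Finset.sum_comm] at hobs
  obtain ⟨s, -, hs⟩ := Finset.exists_lt_of_sum_lt (f := fun _ => (0 : ℝ)) (by simpa using hobs)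
  exact ⟨s, mul_pos (by positivity) hs⟩

theorem isUnit_one_sub_Rfail (hN : 0 < N) (k : Fin K) : IsUnit (1 - M.Rfail k) := by
  obtain ⟨s, hs⟩ := M.exists_pVec_pos hN k
  exact (M.R_irreducible k).isUnit_one_sub_killed (M.R_stochastic k) (M.pVec_mem_Icc hN k) hs

/-- Stationarity gives $\beta\mathbf R^{(\mathrm{succ})}=\beta(\mathbf R-\mathbf
R^{(\mathrm{fail})})=\beta(I-\mathbf R^{(\mathrm{fail})})$, which cancels one of the two inverse
factors. -/
theorem aoiFormula_eq (hN : 0 < N) (k : Fin K) {b : Fin (M.S k) → ℝ}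
    (hb : IsStationaryDistribution (M.R k) b) :
    M.aoiFormula k b = b ⬝ᵥ ((1 - M.Rfail k)⁻¹.mulVec 1) := by
  have hdet := (Matrix.isUnit_iff_isUnit_det _).mp (M.isUnit_one_sub_Rfail hN k)
  have hsucc : M.Rsucc k = M.R k - M.Rfail k := by
    rw [Rsucc, Rfail, sub_mul, one_mul]
    abel
  have hvec : Matrix.vecMul b (M.Rsucc k) = Matrix.vecMul b (1 - M.Rfail k) := by
    rw [hsucc, Matrix.vecMul_sub, Matrix.vecMul_sub, hb.2, Matrix.vecMul_one]
  rw [aoiFormula, Matrix.dotProduct_mulVec, Matrix.dotProduct_mulVec, ← Matrix.vecMul_vecMul,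
    hvec, Matrix.vecMul_vecMul, pow_two, ← mul_assoc, Matrix.mul_nonsing_inv _ hdet, one_mul]

/-! ### Pathwise dynamics and measurability of the age -/

namespace Processes

variable {M} {Ω : Type*} (X : M.Processes Ω)

/-- This deterministic bound supplies integrability and the boundedness of the test functions used
in conditioning. -/
theorem aoi_le (k : Fin K) (t : ℕ) (ω : Ω) : X.aoi k t ω ≤ t := by
  induction t with
  | zero => simp [aoi]
  | succ t ih =>
    rw [aoi]
    split_ifs <;> omega

theorem sum_success_mul_action (k : Fin K) (t : ℕ) (ω : Ω) :
    ∑ n, (X.success t n k ω).toNat * (if X.action t ω = n then 1 else 0)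
      = (X.success t (X.action t ω) k ω).toNat := by
  simp

theorem aoi_succ_eq (k : Fin K) (t : ℕ) (ω : Ω) :
    X.aoi k (t + 1) ω
      = if X.success t (X.action t ω) k ω = true then 1 else X.aoi k t ω + 1 := by
  rw [aoi, sum_success_mul_action]
  cases X.success t (X.action t ω) k ω <;> simp

theorem comap_state_le_sourceHistory (k : Fin K) {j t : ℕ} (h : j ≤ t) :
    MeasurableSpace.comap (X.state j k) ⊤ ≤ X.sourceHistory k t :=
  (le_iSup₂_of_le (f := fun j (_ : j ≤ t) => MeasurableSpace.comap (X.state j k) ⊤)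
    j h le_rfl).trans le_sup_left

theorem comap_action_le_sourceHistory (k : Fin K) {j t : ℕ} (h : j < t) :
    MeasurableSpace.comap (X.action j) ⊤ ≤ X.sourceHistory k t :=
  le_sup_left.trans ((le_iSup₂_of_le (f := fun j (_ : j < t) =>
    MeasurableSpace.comap (X.action j) ⊤ ⊔ ⨆ n, MeasurableSpace.comap (X.success j n k) ⊤)
    j h le_rfl).trans le_sup_right)

theorem comap_success_le_sourceHistory (k : Fin K) (n : Fin N) {j t : ℕ} (h : j < t) :
    MeasurableSpace.comap (X.success j n k) ⊤ ≤ X.sourceHistory k t :=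
  (le_iSup (fun n => MeasurableSpace.comap (X.success j n k) ⊤) n).trans
    (le_sup_right.trans ((le_iSup₂_of_le (f := fun j (_ : j < t) =>
      MeasurableSpace.comap (X.action j) ⊤ ⊔ ⨆ n, MeasurableSpace.comap (X.success j n k) ⊤)
      j h le_rfl).trans le_sup_right))

theorem sourceHistory_mono (k : Fin K) {s t : ℕ} (h : s ≤ t) :
    X.sourceHistory k s ≤ X.sourceHistory k t :=
  sup_le_sup (biSup_mono fun _ hj => hj.trans h) (biSup_mono fun _ hj => hj.trans_le h)

/-- The delivery indicator of source `k` in slot `t`, as a real number. -/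
noncomputable def delivery (k : Fin K) (t : ℕ) (ω : Ω) : ℝ :=
  ∑ n, (X.action t ⁻¹' {n}).indicator (fun _ => (1 : ℝ)) ω
    * (X.success t n k ⁻¹' {true}).indicator (fun _ => (1 : ℝ)) ω

theorem delivery_eq (k : Fin K) (t : ℕ) (ω : Ω) :
    X.delivery k t ω = if X.success t (X.action t ω) k ω = true then 1 else 0 := by
  rw [delivery, Finset.sum_eq_single (X.action t ω)]
  · by_cases h : X.success t (X.action t ω) k ω = true <;> simp [h]
  · intro n _ hn
    simp [hn.symm]
  · simp

theorem cast_aoi_succ (k : Fin K) (t : ℕ) (ω : Ω) :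
    (X.aoi k (t + 1) ω : ℝ) = 1 + X.aoi k t ω * (1 - X.delivery k t ω) := by
  rw [aoi_succ_eq, delivery_eq]
  split_ifs <;> push_cast <;> ring

theorem measurable_delivery {m : MeasurableSpace Ω} (k : Fin K) (t : ℕ)
    (ha : Measurable[m] (X.action t)) (hs : ∀ n, Measurable[m] (X.success t n k)) :
    Measurable[m] (X.delivery k t) :=
  Finset.measurable_sum _ fun n _ =>
    (measurable_const.indicator (ha (measurableSet_singleton n))).mul
      (measurable_const.indicator (hs n (measurableSet_singleton true)))

theorem measurable_aoi (k : Fin K) (t : ℕ) :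
    Measurable[X.sourceHistory k t] (fun ω => (X.aoi k t ω : ℝ)) := by
  induction t with
  | zero =>
    have h : (fun ω => (X.aoi k 0 ω : ℝ)) = fun _ => 0 := by funext ω; simp [aoi]
    rw [h]
    exact @measurable_const _ _ _ (X.sourceHistory k 0) _
  | succ t ih =>
    have hd : Measurable[X.sourceHistory k (t + 1)] (X.delivery k t) :=
      X.measurable_delivery k t
        (measurable_iff_comap_le.mpr (X.comap_action_le_sourceHistory k t.lt_succ_self))
        (fun n => measurable_iff_comap_le.mpr
          (X.comap_success_le_sourceHistory k n t.lt_succ_self))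
    simp only [cast_aoi_succ]
    exact (((ih.mono (X.sourceHistory_mono k t.le_succ) le_rfl).mul
      (hd.const_sub 1)).const_add 1)

theorem measurable_state_sourceHistory (k : Fin K) (t : ℕ) :
    Measurable[X.sourceHistory k t] (X.state t k) :=
  measurable_iff_comap_le.mpr (X.comap_state_le_sourceHistory k le_rfl)

/-! ### One-step conditional expectations -/

section Evolution

variable {X} [mΩ : MeasurableSpace Ω] {μ : Measure Ω}

theorem IsSystemEvolution.sourceHistory_le (hX : X.IsSystemEvolution μ) (k : Fin K) (t : ℕ) :
    X.sourceHistory k t ≤ mΩ :=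
  sup_le (iSup₂_le fun j _ => (hX.measurable_state j k).comap_le)
    (iSup₂_le fun j _ => sup_le (hX.measurable_action j).comap_le
      (iSup_le fun n => (hX.measurable_success j n k).comap_le))

variable [IsProbabilityMeasure μ]

theorem IsSystemEvolution.integrable_aoi (hX : X.IsSystemEvolution μ) (k : Fin K) (t : ℕ) :
    Integrable (fun ω => (X.aoi k t ω : ℝ)) μ := by
  refine Integrable.of_bound
    ((X.measurable_aoi k t).mono (hX.sourceHistory_le k t) le_rfl).aestronglyMeasurable (t : ℝ)
    (Eventually.of_forall fun ω => ?_)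
  rw [Real.norm_natCast]
  exact_mod_cast X.aoi_le k t ω

/-- One-step prediction of the next state from a quantity known at the end of slot `t`. -/
theorem IsSystemEvolution.integral_mul_next_state (hX : X.IsSystemEvolution μ) (k : Fin K)
    (t : ℕ) (j : Fin (M.S k)) {h : Ω → ℝ}
    (hh : Measurable[X.sourceHistory k t ⊔ MeasurableSpace.comap (X.action t) ⊤ ⊔
      ⨆ n, MeasurableSpace.comap (X.success t n k) ⊤] h) {C : ℝ} (hC : ∀ ω, |h ω| ≤ C) :
    ∫ ω, h ω * (X.state (t + 1) k ⁻¹' {j}).indicator (fun _ => (1 : ℝ)) ω ∂μ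
      = ∫ ω, h ω * M.R k (X.state t k ω) j ∂μ :=
  integral_mul_indicator_of_condExp_ae_eq
    (sup_le (sup_le (hX.sourceHistory_le k t) (hX.measurable_action t).comap_le)
      (iSup_le fun n => (hX.measurable_success t n k).comap_le))
    (hX.measurable_state (t + 1) k (measurableSet_singleton j)) (hX.state_law t k j) hh hC

/-- Under random sampling, a delivery in slot `t` has conditional probability
`p_k(s_k(t))` given the history of source `k`. -/
theorem IsSystemEvolution.integral_mul_delivery (hX : X.IsSystemEvolution μ)
    (hrand : X.IsRandomSampling μ) (k : Fin K) (t : ℕ) {h : Ω → ℝ}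
    (hh : Measurable[X.sourceHistory k t] h) {C : ℝ} (hC : ∀ ω, |h ω| ≤ C) :
    ∫ ω, h ω * X.delivery k t ω ∂μ = ∫ ω, h ω * M.pVec k (X.state t k ω) ∂μ := by
  have hF := hX.sourceHistory_le k t
  have hhΩ : Measurable h := hh.mono hF le_rfl
  have hhint : Integrable h μ :=
    Integrable.of_bound hhΩ.aestronglyMeasurable C (Eventually.of_forall hC)
  have hAm : ∀ n, MeasurableSet (X.action t ⁻¹' {n}) := fun n =>
    hX.measurable_action t (measurableSet_singleton n)
  have hBm : ∀ n, MeasurableSet (X.success t n k ⁻¹' {true}) := fun n =>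
    hX.measurable_success t n k (measurableSet_singleton true)
  have hrate : ∀ n, Measurable[X.sourceHistory k t]
      (fun ω => M.p n k (X.state t k ω) * M.q n) := fun n =>
    (measurable_of_finite fun s => M.p n k s * M.q n).comp (X.measurable_state_sourceHistory k t)
  have hrate_le : ∀ n ω, |M.p n k (X.state t k ω) * M.q n| ≤ 1 := fun n ω => by
    rw [abs_of_nonneg (mul_nonneg (M.p_mem _ _ _).1 (M.q_mem _).1)]
    exact mul_le_one₀ (M.p_mem _ _ _).2 (M.q_mem _).1 (M.q_mem _).2
  have hind : ∀ (A : Set Ω) ω, |A.indicator (fun _ => (1 : ℝ)) ω| ≤ 1 := fun A ω => by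
    by_cases hω : ω ∈ A <;> simp [hω]
  have hstep : ∀ n, ∫ ω, h ω * ((X.action t ⁻¹' {n}).indicator (fun _ => (1 : ℝ)) ω
      * (X.success t n k ⁻¹' {true}).indicator (fun _ => (1 : ℝ)) ω) ∂μ
      = ∫ ω, h ω * (1 / (N : ℝ) * (M.q n * M.p n k (X.state t k ω))) ∂μ := by
    intro n
    have hA : Measurable[X.sourceHistory k t ⊔ MeasurableSpace.comap (X.action t) ⊤]
        ((X.action t ⁻¹' {n}).indicator fun _ => (1 : ℝ)) :=
      measurable_const.indicator
        (le_sup_right (a := X.sourceHistory k t) _ ⟨{n}, trivial, rfl⟩)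
    -- The success law is conditional on the action too, so the action indicator belongs to the test
    -- function here and is averaged only afterwards, in `h2`.
    have h1 := integral_mul_indicator_of_condExp_ae_eq
      (sup_le hF (hX.measurable_action t).comap_le) (hBm n) (hX.success_law t n k)
      ((hh.mono le_sup_left le_rfl).mul hA) (C := C)
      (fun ω => by
        rw [Pi.mul_apply, abs_mul]
        exact (mul_le_of_le_one_right (abs_nonneg _) (hind _ ω)).trans (hC ω))
    -- The policy is uniform given the joint history, which contains that of source `k`; the success
    -- rate, depending on the current state only, is known there.
    have hH : X.history t ≤ mΩ := iSup_le fun k => hX.sourceHistory_le k t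
    have h2 := integral_mul_indicator_of_condExp_ae_eq hH (hAm n) (hrand t n)
      ((hh.mul (hrate n)).mono (le_iSup (fun k => X.sourceHistory k t) k) le_rfl) (C := C)
      (fun ω => by
        rw [Pi.mul_apply, abs_mul]
        exact (mul_le_of_le_one_right (abs_nonneg _) (hrate_le n ω)).trans (hC ω))
    simp only [Pi.mul_apply] at h1 h2
    calc _ = ∫ ω, h ω * (X.action t ⁻¹' {n}).indicator (fun _ => (1 : ℝ)) ω
          * (X.success t n k ⁻¹' {true}).indicator (fun _ => (1 : ℝ)) ω ∂μ := by
          simp only [mul_assoc]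
      _ = ∫ ω, h ω * (M.p n k (X.state t k ω) * M.q n)
          * (X.action t ⁻¹' {n}).indicator (fun _ => (1 : ℝ)) ω ∂μ := by
          rw [h1]
          exact integral_congr_ae (Eventually.of_forall fun ω => by ring)
      _ = _ := by
          rw [h2]
          exact integral_congr_ae (Eventually.of_forall fun ω => by ring)
  simp only [delivery, pVec, Finset.mul_sum]
  rw [integral_finsetSum, integral_finsetSum]
  · exact Finset.sum_congr rfl fun n _ => hstep n
  · intro n _
    refine hhint.mul_bdd (c := 1 / (N : ℝ)) ?_ (Eventually.of_forall fun ω => ?_)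
    · have := ((hrate n).mono hF le_rfl).const_mul (1 / (N : ℝ))
      simpa only [mul_comm (M.p _ _ _)] using this.aestronglyMeasurable
    · rw [norm_mul, Real.norm_of_nonneg (by positivity), mul_comm (M.q n)]
      exact mul_le_of_le_one_right (by positivity) (hrate_le n ω)
  · intro n _
    refine hhint.mul_bdd (c := 1) ?_ (Eventually.of_forall fun ω => ?_)
    · exact ((measurable_const.indicator (hAm n)).mul
        (measurable_const.indicator (hBm n))).aestronglyMeasurable
    · rw [norm_mul]
      exact mul_le_one₀ (hind _ ω) (norm_nonneg _) (hind _ ω)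

end Evolution

/-! ### Recursion for the expected age split by state -/

/-- The law of the state of source `k` in slot `t`. -/
noncomputable def stateLaw [MeasurableSpace Ω] (μ : Measure Ω) (k : Fin K) (t : ℕ)
    (j : Fin (M.S k)) : ℝ :=
  ∫ ω, (X.state t k ⁻¹' {j}).indicator (fun _ => (1 : ℝ)) ω ∂μ

/-- The expected age of source `k` in slot `t`, split according to the state of the source. -/
noncomputable def aoiByState [MeasurableSpace Ω] (μ : Measure Ω) (k : Fin K) (t : ℕ)
    (j : Fin (M.S k)) : ℝ :=
  ∫ ω, (X.aoi k t ω : ℝ) * (X.state t k ⁻¹' {j}).indicator (fun _ => (1 : ℝ)) ω ∂μ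

theorem aoiByState_zero [MeasurableSpace Ω] (μ : Measure Ω) (k : Fin K) : X.aoiByState μ k 0 = 0 := by
  funext j
  simp [aoiByState, aoi]

theorem aoiByState_nonneg [MeasurableSpace Ω] (μ : Measure Ω) (k : Fin K) (t : ℕ) (j : Fin (M.S k)) : 0 ≤ X.aoiByState μ k t j :=
  integral_nonneg fun ω => mul_nonneg (Nat.cast_nonneg _)
    (Set.indicator_nonneg (fun _ _ => zero_le_one) ω)

theorem sum_indicator_state (k : Fin K) (t : ℕ) (f : Fin (M.S k) → ℝ) (ω : Ω) :
    ∑ i, (X.state t k ⁻¹' {i}).indicator (fun _ => (1 : ℝ)) ω * f i = f (X.state t k ω) := by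
  rw [Finset.sum_eq_single (X.state t k ω)]
  · simp
  · intro i _ hi
    simp [hi.symm]
  · simp

section Recursion

variable {X} [mΩ : MeasurableSpace Ω] {μ : Measure Ω} [IsProbabilityMeasure μ]

theorem IsSystemEvolution.integrable_indicator_state (hX : X.IsSystemEvolution μ) (k : Fin K)
    (t : ℕ) (j : Fin (M.S k)) :
    Integrable ((X.state t k ⁻¹' {j}).indicator fun _ => (1 : ℝ)) μ :=
  (integrable_const _).indicator (hX.measurable_state t k (measurableSet_singleton j))

theorem IsSystemEvolution.integrable_mul_indicator_state (hX : X.IsSystemEvolution μ)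
    (k : Fin K) (t : ℕ) (j : Fin (M.S k)) {h : Ω → ℝ} (hh : Integrable h μ) :
    Integrable (fun ω => h ω * (X.state t k ⁻¹' {j}).indicator (fun _ => (1 : ℝ)) ω) μ := by
  refine hh.mul_bdd (c := 1) (hX.integrable_indicator_state k t j).aestronglyMeasurable
    (Eventually.of_forall fun ω => ?_)
  by_cases hω : X.state t k ω = j <;> simp [hω]

/-- Disintegration of an expectation over the state of source `k`. -/
theorem IsSystemEvolution.integral_mul_comp_state (hX : X.IsSystemEvolution μ) (k : Fin K)
    (t : ℕ) (f : Fin (M.S k) → ℝ) {h : Ω → ℝ} (hh : Integrable h μ) :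
    ∫ ω, h ω * f (X.state t k ω) ∂μ
      = (fun i => ∫ ω, h ω * (X.state t k ⁻¹' {i}).indicator (fun _ => (1 : ℝ)) ω ∂μ) ⬝ᵥ f := by
  simp only [← X.sum_indicator_state k t f, Finset.mul_sum, ← mul_assoc]
  rw [integral_finsetSum _ fun i _ =>
    (hX.integrable_mul_indicator_state k t i hh).mul_const (f i)]
  simp only [integral_mul_const, dotProduct]

theorem IsSystemEvolution.stateLaw_succ (hX : X.IsSystemEvolution μ) (k : Fin K) (t : ℕ) :
    X.stateLaw μ k (t + 1) = Matrix.vecMul (X.stateLaw μ k t) (M.R k) := by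
  funext j
  have h1 := hX.integral_mul_next_state k t j (h := fun _ => 1) measurable_const (C := 1)
    (fun _ => by simp)
  have h2 := hX.integral_mul_comp_state k t (fun i => M.R k i j) (integrable_const (1 : ℝ))
  rw [h2] at h1
  simp only [one_mul] at h1
  exact h1

theorem IsSystemEvolution.stateLaw_mem_stdSimplex (hX : X.IsSystemEvolution μ) (k : Fin K)
    (t : ℕ) : X.stateLaw μ k t ∈ stdSimplex ℝ (Fin (M.S k)) := by
  refine ⟨fun j => integral_nonneg fun ω => Set.indicator_nonneg (fun _ _ => zero_le_one) ω, ?_⟩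
  have h := hX.integral_mul_comp_state k t (fun _ => 1) (integrable_const (1 : ℝ))
  simp only [one_mul, integral_const, probReal_univ, smul_eq_mul, dotProduct, mul_one] at h
  exact h.symm

theorem IsSystemEvolution.sum_aoiByState (hX : X.IsSystemEvolution μ) (k : Fin K) (t : ℕ) :
    ∑ j, X.aoiByState μ k t j = ∫ ω, (X.aoi k t ω : ℝ) ∂μ := by
  have h := hX.integral_mul_comp_state k t (fun _ => 1) (hX.integrable_aoi k t)
  simp only [mul_one, dotProduct] at h
  exact h.symm

/-- The `1` in the age update contributes the state law. The surviving old age is averaged backwards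
in time: first over the next state, given everything in slot `t`, then over the delivery, given the
history before it. -/
theorem IsSystemEvolution.aoiByState_succ (hX : X.IsSystemEvolution μ)
    (hrand : X.IsRandomSampling μ) (k : Fin K) (t : ℕ) :
    X.aoiByState μ k (t + 1)
      = X.stateLaw μ k (t + 1) + Matrix.vecMul (X.aoiByState μ k t) (M.Rfail k) := by
  funext j
  have hF := hX.sourceHistory_le k t
  have haoi_le : ∀ ω, |(X.aoi k t ω : ℝ)| ≤ t := fun ω => by
    rw [Nat.abs_cast]
    exact_mod_cast X.aoi_le k t ω
  have hdel : ∀ ω, X.delivery k t ω = 0 ∨ X.delivery k t ω = 1 := fun ω => by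
    rw [delivery_eq]
    split_ifs <;> simp
  have hdelm : Measurable (X.delivery k t) :=
    X.measurable_delivery k t (hX.measurable_action t) fun n => hX.measurable_success t n k
  have hR1 : ∀ i, |M.R k i j| ≤ 1 := fun i => by
    rw [abs_of_nonneg ((M.R_irreducible k).nonneg i j)]
    exact Matrix.le_one_of_mem_rowStochastic (M.R_stochastic k)
  have hRm : Measurable[X.sourceHistory k t] (fun ω => M.R k (X.state t k ω) j) :=
    (measurable_of_finite fun s => M.R k s j).comp (X.measurable_state_sourceHistory k t)
  have haRint : Integrable (fun ω => (X.aoi k t ω : ℝ) * M.R k (X.state t k ω) j) μ :=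
    (hX.integrable_aoi k t).mul_bdd (c := 1) (hRm.mono hF le_rfl).aestronglyMeasurable
      (Eventually.of_forall fun ω => hR1 _)
  have hfail_int : Integrable (fun ω => (X.aoi k t ω : ℝ) * (1 - X.delivery k t ω)) μ :=
    (hX.integrable_aoi k t).mul_bdd (c := 1) (hdelm.const_sub 1).aestronglyMeasurable
      (Eventually.of_forall fun ω => by rcases hdel ω with h | h <;> simp [h])
  have hdel_known : Measurable[X.sourceHistory k t ⊔ MeasurableSpace.comap (X.action t) ⊤ ⊔
      ⨆ n, MeasurableSpace.comap (X.success t n k) ⊤] (X.delivery k t) :=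
    X.measurable_delivery (m := _) k t
      (measurable_iff_comap_le.mpr (le_sup_right.trans le_sup_left))
      (fun n => measurable_iff_comap_le.mpr
        ((le_iSup (fun n => MeasurableSpace.comap (X.success t n k) ⊤) n).trans le_sup_right))
  have hnext := hX.integral_mul_next_state k t j (C := (t : ℝ))
    (h := fun ω => (X.aoi k t ω : ℝ) * (1 - X.delivery k t ω))
    (((X.measurable_aoi k t).mono (le_sup_left.trans le_sup_left) le_rfl).mul
      (hdel_known.const_sub 1))
    (fun ω => by rcases hdel ω with h | h <;> simp [h]; exact_mod_cast X.aoi_le k t ω)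
  have hdeliv := hX.integral_mul_delivery hrand k t (C := (t : ℝ))
    (h := fun ω => (X.aoi k t ω : ℝ) * M.R k (X.state t k ω) j)
    ((X.measurable_aoi k t).mul hRm)
    (fun ω => by
      rw [abs_mul]
      exact (mul_le_of_le_one_right (abs_nonneg _) (hR1 _)).trans (haoi_le ω))
  have hdis : ∫ ω, (X.aoi k t ω : ℝ)
        * (M.R k (X.state t k ω) j * M.pVec k (X.state t k ω)) ∂μ
      = X.aoiByState μ k t ⬝ᵥ fun i => M.R k i j * M.pVec k i :=
    hX.integral_mul_comp_state k t (fun i => M.R k i j * M.pVec k i) (hX.integrable_aoi k t)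
  have hdis' : ∫ ω, (X.aoi k t ω : ℝ) * M.R k (X.state t k ω) j ∂μ
      = X.aoiByState μ k t ⬝ᵥ fun i => M.R k i j :=
    hX.integral_mul_comp_state k t (fun i => M.R k i j) (hX.integrable_aoi k t)
  have hsplit : X.aoiByState μ k (t + 1) j = X.stateLaw μ k (t + 1) j
      + ∫ ω, (X.aoi k t ω : ℝ) * (1 - X.delivery k t ω)
        * (X.state (t + 1) k ⁻¹' {j}).indicator (fun _ => (1 : ℝ)) ω ∂μ := by
    rw [aoiByState, stateLaw, ← integral_add (hX.integrable_indicator_state k (t + 1) j)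
      (hX.integrable_mul_indicator_state k (t + 1) j hfail_int)]
    simp only [cast_aoi_succ, add_mul, one_mul]
  have hexpand : ∫ ω, (X.aoi k t ω : ℝ) * (1 - X.delivery k t ω)
        * M.R k (X.state t k ω) j ∂μ
      = ∫ ω, (X.aoi k t ω : ℝ) * M.R k (X.state t k ω) j ∂μ
        - ∫ ω, (X.aoi k t ω : ℝ) * M.R k (X.state t k ω) j * X.delivery k t ω ∂μ := by
    rw [← integral_sub haRint (haRint.mul_bdd (c := 1) hdelm.aestronglyMeasurable
      (Eventually.of_forall fun ω => by rcases hdel ω with h | h <;> simp [h]))]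
    exact integral_congr_ae (Eventually.of_forall fun ω => by ring)
  rw [hsplit, Pi.add_apply, hnext, hexpand, hdeliv]
  simp only [mul_assoc]
  rw [hdis, hdis', ← dotProduct_sub]
  congr 2
  funext i
  rw [Rfail, sub_mul, one_mul, Matrix.sub_apply, Matrix.diagonal_mul, Pi.sub_apply, mul_comm]

/-- The expected long-term average age of a single source. -/
theorem IsSystemEvolution.tendsto_average_aoi (hX : X.IsSystemEvolution μ)
    (hrand : X.IsRandomSampling μ) (hN : 0 < N) (k : Fin K) {b : Fin (M.S k) → ℝ}
    (hb : IsStationaryDistribution (M.R k) b) :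
    Tendsto (fun T : ℕ => (1 / (T : ℝ)) * ∫ ω, ∑ t ∈ Finset.Icc 1 T, (X.aoi k t ω : ℝ) ∂μ)
      atTop (𝓝 (M.aoiFormula k b)) := by
  obtain ⟨s, hs⟩ := M.exists_pVec_pos hN k
  have h := (M.R_irreducible k).tendsto_cesaro_mass (M.R_stochastic k) (M.pVec_mem_Icc hN k) hs
    hb (hX.stateLaw_mem_stdSimplex k) (hX.stateLaw_succ k) (X.aoiByState_nonneg μ k)
    (X.aoiByState_zero μ k) (hX.aoiByState_succ hrand k)
  rw [M.aoiFormula_eq hN k hb]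
  refine h.congr fun T => ?_
  rw [integral_finsetSum _ fun t _ => hX.integrable_aoi k t]
  simp only [hX.sum_aoiByState]

end Recursion

end Processes

end SensingSystem

/-! ### The limits for each source and for the system -/

theorem theorem1 {N K : ℕ} (M : SensingSystem N K)
    (β : (k : Fin K) → Fin (M.S k) → ℝ)
    (hβ : ∀ k, IsStationaryDistribution (M.R k) (β k))
    {Ω : Type*} [MeasurableSpace Ω] (μ : Measure Ω) [IsProbabilityMeasure μ]
    (X : M.Processes Ω) (hX : X.IsSystemEvolution μ) (hrand : X.IsRandomSampling μ) :
    (∀ k, IsUnit (1 - M.Rfail k)) ∧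
    (∀ k t, Integrable (fun ω => (X.aoi k t ω : ℝ)) μ) ∧
    (∀ k, Tendsto
      (fun T : ℕ => (1 / (T : ℝ)) * ∫ ω, ∑ t ∈ Finset.Icc 1 T, (X.aoi k t ω : ℝ) ∂μ)
      atTop (𝓝 (M.aoiFormula k (β k)))) ∧
    Tendsto
      (fun T : ℕ => (1 / (T : ℝ)) * ∫ ω, ∑ t ∈ Finset.Icc 1 T, X.avgAoi t ω ∂μ)
      atTop (𝓝 ((1 / (K : ℝ)) * ∑ k, M.aoiFormula k (β k))) := by
  -- A probability space has a point, and the action there is an element of `Fin N`; hence `N` is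
  -- positive.
  obtain ⟨ω₀⟩ := nonempty_of_isProbabilityMeasure μ
  have hN : 0 < N := (X.action 0 ω₀).pos
  have hint : ∀ k t, Integrable (fun ω => (X.aoi k t ω : ℝ)) μ := hX.integrable_aoi
  have hlim := fun k => hX.tendsto_average_aoi hrand hN k (hβ k)
  refine ⟨M.isUnit_one_sub_Rfail hN, hint, hlim, ?_⟩
  refine ((tendsto_finsetSum _ fun k _ => hlim k).const_mul (1 / (K : ℝ))).congr fun T => ?_
  have hswap : ∀ ω, ∑ t ∈ Finset.Icc 1 T, X.avgAoi t ω
      = 1 / (K : ℝ) * ∑ k, ∑ t ∈ Finset.Icc 1 T, (X.aoi k t ω : ℝ) := fun ω => by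
    simp only [SensingSystem.Processes.avgAoi]
    rw [← Finset.mul_sum, Finset.sum_comm]
  simp only [hswap]
  rw [integral_const_mul, integral_finsetSum _ fun k _ =>
    integrable_finsetSum _ fun t _ => hint k t, ← Finset.mul_sum]
  ring
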